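/- **Theorem 3.5.** Let $a_{jk}$ $(j,k=1,2)$ be real valued continuous functions on $[t_0,+\infty)$, and consider the system $$\phi'=a_{11}(t)\phi+a_{12}(t)\psi,\qquad \psi'=a_{21}(t)\phi+a_{22}(t)\psi,\qquad t\ge t_0. \tag{1.1}$$ Put $J_S(t)=\exp\Bigl\{\int_{t_0}^t[a_{11}(\tau)+a_{22}(\tau)]\,d\tau\Bigr\}$. All improper integrals $\int_t^{+\infty}$ are limits $\lim_{b\to+\infty}\int_t^b$ (conditional convergence is allowed). Definitions. Solutions of (1.1) are understood on $[t_0,+\infty)$ and are real valued unless stated otherwise. A solution $(\phi,\psi)$ is *$t_1$-regular* if $\phi(t)\ne0$ for all $t\ge t_1$, and *regular* if it is $t_1$-regular for some $t_1\ge t_0$. The system is *exotic* if it has a regular solution and this solution is unique up to a constant multiplier. A regular solution $(\phi_*,\psi_*)$ is *minimal* if $\lim_{t\to+\infty}\phi_*(t)/\phi(t)=0$ for every regular solution $(\phi,\psi)$ linearly independent of $(\phi_*,\psi_*)$. The system is *extremal* if it is not exotic and has a minimal solution. Suppose that for some $t_1\ge t_0$ there is a real valued $t_1$-regular solution $(\phi_0,\psi_0)$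 of (1.1) such that the integral $\int_{t_1}^{+\infty}\frac{a_{12}(\tau)J_S(\tau)}{\phi_0^2(\tau)}d\tau$ converges and $\int_{t}^{+\infty}\frac{a_{12}(\tau)J_S(\tau)}{\phi_0^2(\tau)}d\tau\neq0$ for all $t\ge t_1$. Then: a) The system (1.1) is extremal; its minimal solution $(\phi_*,\psi_*)$ is unique up to a nonzero constant multiplier and is $t_1$-regular, and $$\int_{t_1}^{+\infty}\frac{a_{12}(\tau)J_S(\tau)}{\phi_*^2(\tau)}d\tau=+\infty\quad\text{or}\quad=-\infty.$$ b) Every real or complex valued solution $(\phi,\psi)$ linearly independent of $(\phi_*,\psi_*)$ (over $\mathbb R$, respectively over $\mathbb C$) is regular, i.e. $\phi(t)\neq 0$ for all sufficiently large $t$. For every $T\ge t_0$ such that $\phi(t)\ne0$ for all $t\ge T$, the integral $\int_{T}^{+\infty}\frac{a_{12}(\tau)J_S(\tau)}{\phi^2(\tau)}d\tau$ converges. If in addition $a_{12}$ does not change sign on $[t_0,+\infty)$ and $\int_{t_0}^{+\infty}|a_{12}(\tau)J_S(\tau)|\,d\tau=+\infty$, then $$\limsup_{t\to+\infty}|\phi(t)|=+\infty.$$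 c) For any real valued solutions $(\phi_1,\psi_1)$, $(\phi_2,\psi_2)$ of (1.1), each linearly independent of $(\phi_*,\psi_*)$ (but not necessarily of each other), the limit $\lim_{t\to+\infty}\frac{\phi_1(t)}{\phi_2(t)}$ exists, is finite and is nonzero. -/

import Mathlib

open Filter Topology

/-- A planar linear system `φ' = a₁₁ φ + a₁₂ ψ`, `ψ' = a₂₁ φ + a₂₂ ψ` on `[t₀, ∞)` with real valued
continuous coefficients.  (Values of the coefficients to the left of `t₀` are never used.) -/
structure PlanarSystem where
  t₀ : ℝ
  a₁₁ : ℝ → ℝ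
  a₁₂ : ℝ → ℝ
  a₂₁ : ℝ → ℝ
  a₂₂ : ℝ → ℝ
  cont₁₁ : ContinuousOn a₁₁ (Set.Ici t₀)
  cont₁₂ : ContinuousOn a₁₂ (Set.Ici t₀)
  cont₂₁ : ContinuousOn a₂₁ (Set.Ici t₀)
  cont₂₂ : ContinuousOn a₂₂ (Set.Ici t₀)

namespace PlanarSystem

variable (sys : PlanarSystem)

/-- `(φ, ψ)` is a (real or complex valued) solution of the system on `[t₀, ∞)`; the derivative at
the end point `t₀` is one-sided. -/
def IsSolution {𝕜 : Type*} [RCLike 𝕜] (φ ψ : ℝ → 𝕜) : Prop :=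
  ∀ t, sys.t₀ ≤ t →
    HasDerivWithinAt φ (sys.a₁₁ t • φ t + sys.a₁₂ t • ψ t) (Set.Ici sys.t₀) t ∧
    HasDerivWithinAt ψ (sys.a₂₁ t • φ t + sys.a₂₂ t • ψ t) (Set.Ici sys.t₀) t

/-- `(φ, ψ)` is a `t₁`-regular solution: a solution with `φ(t) ≠ 0` for all `t ≥ t₁`. -/
def IsRegularFrom {𝕜 : Type*} [RCLike 𝕜] (t₁ : ℝ) (φ ψ : ℝ → 𝕜) : Prop :=
  sys.IsSolution φ ψ ∧ ∀ t, t₁ ≤ t → φ t ≠ 0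

/-- `(φ, ψ)` is a regular solution: a `t₁`-regular solution for some `t₁ ≥ t₀`. -/
def IsRegularSolution {𝕜 : Type*} [RCLike 𝕜] (φ ψ : ℝ → 𝕜) : Prop :=
  ∃ t₁, sys.t₀ ≤ t₁ ∧ sys.IsRegularFrom t₁ φ ψ

/-- `(φ₁, ψ₁)` and `(φ₂, ψ₂)` are linearly independent as vector functions on `[t₀, ∞)`. -/
def LinIndep {𝕜 : Type*} [RCLike 𝕜] (φ₁ ψ₁ φ₂ ψ₂ : ℝ → 𝕜) : Prop :=
  ∀ c₁ c₂ : 𝕜,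
    (∀ t, sys.t₀ ≤ t → c₁ * φ₁ t + c₂ * φ₂ t = 0 ∧ c₁ * ψ₁ t + c₂ * ψ₂ t = 0) → c₁ = 0 ∧ c₂ = 0

/-- The system is exotic: it has a real valued regular solution, and this solution is unique up to
a constant multiplier. -/
def IsExotic : Prop :=
  ∃ φ ψ : ℝ → ℝ, sys.IsRegularSolution φ ψ ∧
    ∀ φ' ψ' : ℝ → ℝ, sys.IsRegularSolution φ' ψ' →
      ∃ c : ℝ, ∀ t, sys.t₀ ≤ t → φ' t = c * φ t ∧ ψ' t = c * ψ t

/-- `(φ, ψ)` is a regular solution whose first component is negligible at infinity compared to that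
of every regular solution linearly independent of it. -/
def IsMinimalSolution (φ ψ : ℝ → ℝ) : Prop :=
  sys.IsRegularSolution φ ψ ∧
    ∀ φ' ψ' : ℝ → ℝ, sys.IsRegularSolution φ' ψ' → sys.LinIndep φ' ψ' φ ψ →
      Tendsto (fun t => φ t / φ' t) atTop (𝓝 0)

/-- The system is extremal: it is not exotic and it has a minimal solution. -/
def IsExtremal : Prop :=
  ¬ sys.IsExotic ∧ ∃ φ ψ : ℝ → ℝ, sys.IsMinimalSolution φ ψ

/-- `J_S(t) = exp (∫_{t₀}^t S(τ) dτ)` with `S = a₁₁ + a₂₂`. -/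
noncomputable def JS (t : ℝ) : ℝ :=
  Real.exp (∫ τ in sys.t₀..t, (sys.a₁₁ τ + sys.a₂₂ τ))

/-- The partial integral `∫_s^t a₁₂(τ) J_S(τ) / φ(τ)² dτ`.  The improper integrals over `[s, ∞)` are
the limits of this for `t → ∞`, in the sense of conditional convergence. -/
noncomputable def partialIntegral {𝕜 : Type*} [RCLike 𝕜] (φ : ℝ → 𝕜) (s t : ℝ) : 𝕜 :=
  ∫ τ in s..t, (sys.a₁₂ τ * sys.JS τ) • ((φ τ) ^ 2)⁻¹

end PlanarSystem

namespace PlanarSystem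

/-! Let `y` complete `φ₀` to a fundamental pair with Wronskian `J_S`. Then `(y/φ₀)' = a₁₂ J_S/φ₀²`,
so convergence of the integral gives `y/φ₀` a limit `c`, and `u = c φ₀ - y` satisfies `u(t)/φ₀(t) =
∫_t^∞ a₁₂ J_S/φ₀²`. By hypothesis this tail never vanishes on `[t₁, ∞)`, and it tends to `0`
(`exists_isDominatedPair`).

The rest is asymptotics in the basis `(φ₀, u)`. A solution `z = α φ₀ + β u` has `z/φ₀ → α`, and
independence from `u` forces `α ≠ 0`. Hence such `z` are eventually nonzero, have nonzero limiting
ratios and dominate `u`. Up to constants, `u/z` is an antiderivative of `a₁₂ J_S/z²` and `φ₀/u` one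
of `a₁₂ J_S/u²`: the first converges, the second blows up with a fixed sign. -/

theorem hasDerivWithinAt_integral_Ici {f : ℝ → ℝ} {a t : ℝ} (hf : ContinuousOn f (Set.Ici a))
    (ht : a ≤ t) : HasDerivWithinAt (fun u => ∫ τ in a..u, f τ) (f t) (Set.Ici a) t := by
  -- Freezing `f` at its value at `a` to the left of `a` makes it continuous on `ℝ`, so the
  -- two-sided theorem applies.
  have hg : Continuous (fun τ => f (max a τ)) :=
    hf.comp_continuous (continuous_const.max continuous_id) fun τ => le_max_left a τ
  have hd : HasDerivAt (fun u => ∫ τ in a..u, f (max a τ)) (f (max a t)) t :=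
    intervalIntegral.integral_hasDerivAt_right (hg.intervalIntegrable _ _)
      (hg.stronglyMeasurableAtFilter _ _) hg.continuousAt
  rw [max_eq_right ht] at hd
  have hc : ∀ u ∈ Set.Ici a, ∫ τ in a..u, f τ = ∫ τ in a..u, f (max a τ) := by
    intro u hu
    refine intervalIntegral.integral_congr fun τ hτ => ?_
    rw [Set.uIcc_of_le hu] at hτ
    simp only [max_eq_right hτ.1]
  exact hd.hasDerivWithinAt.congr hc (hc t ht)

theorem integral_eq_sub_of_hasDerivWithinAt_Ici {E : Type*} [NormedAddCommGroup E]
    [NormedSpace ℝ E] [CompleteSpace E] {f g : ℝ → E} {a s t : ℝ}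
    (hf : ∀ τ, a ≤ τ → HasDerivWithinAt f (g τ) (Set.Ici a) τ)
    (hg : ContinuousOn g (Set.Ici a)) (hs : a ≤ s) (hst : s ≤ t) :
    ∫ τ in s..t, g τ = f t - f s := by
  refine intervalIntegral.integral_eq_sub_of_hasDeriv_right_of_le hst ?_ ?_ ?_
  · exact fun τ hτ => ((hf τ (hs.trans hτ.1)).continuousWithinAt).mono
      fun y hy => hs.trans hy.1
  · exact fun τ hτ => (hf τ (hs.trans hτ.1.le)).mono
      fun y hy => hs.trans (hτ.1.le.trans (le_of_lt hy))
  · refine ContinuousOn.intervalIntegrable (hg.mono fun y hy => ?_)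
    rw [Set.uIcc_of_le hst] at hy
    exact hs.trans hy.1

theorem eq_of_hasDerivWithinAt_Ici_zero {E : Type*} [NormedAddCommGroup E] [NormedSpace ℝ E]
    {f : ℝ → E} {a t : ℝ} (hf : ∀ τ, a ≤ τ → HasDerivWithinAt f 0 (Set.Ici a) τ) (ht : a ≤ t) :
    f t = f a := by
  refine constant_of_has_deriv_right_zero (b := t) ?_ ?_ t ⟨ht, le_rfl⟩
  · exact fun τ hτ => (hf τ hτ.1).continuousWithinAt.mono fun y hy => hy.1
  · exact fun τ hτ => (hf τ hτ.1).mono fun y hy => hτ.1.trans hy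

/-! ### Solutions, Wronskians and reduction of order -/

variable (sys : PlanarSystem)

theorem JS_pos (t : ℝ) : 0 < sys.JS t := Real.exp_pos _

theorem JS_hasDerivWithinAt {t : ℝ} (ht : sys.t₀ ≤ t) :
    HasDerivWithinAt sys.JS (sys.JS t * (sys.a₁₁ t + sys.a₂₂ t)) (Set.Ici sys.t₀) t :=
  (hasDerivWithinAt_integral_Ici (sys.cont₁₁.add sys.cont₂₂) ht).exp

theorem JS_continuousOn : ContinuousOn sys.JS (Set.Ici sys.t₀) :=
  fun _ ht => (sys.JS_hasDerivWithinAt ht).continuousWithinAt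

variable {sys}

namespace IsSolution

variable {𝕜 : Type*} [RCLike 𝕜] {φ ψ φ₁ ψ₁ φ₂ ψ₂ : ℝ → 𝕜}

theorem continuousOn_fst (h : sys.IsSolution φ ψ) : ContinuousOn φ (Set.Ici sys.t₀) :=
  fun t ht => (h t ht).1.continuousWithinAt

theorem continuousOn_snd (h : sys.IsSolution φ ψ) : ContinuousOn ψ (Set.Ici sys.t₀) :=
  fun t ht => (h t ht).2.continuousWithinAt

theorem add (h₁ : sys.IsSolution φ₁ ψ₁) (h₂ : sys.IsSolution φ₂ ψ₂) :
    sys.IsSolution (fun t => φ₁ t + φ₂ t) (fun t => ψ₁ t + ψ₂ t) := by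
  intro t ht
  refine ⟨((h₁ t ht).1.add (h₂ t ht).1).congr_deriv ?_,
    ((h₁ t ht).2.add (h₂ t ht).2).congr_deriv ?_⟩ <;>
  simp only [smul_add] <;> abel

theorem const_mul (c : 𝕜) (h : sys.IsSolution φ ψ) :
    sys.IsSolution (fun t => c * φ t) (fun t => c * ψ t) := by
  intro t ht
  refine ⟨((h t ht).1.const_mul c).congr_deriv ?_, ((h t ht).2.const_mul c).congr_deriv ?_⟩ <;>
  simp only [mul_add, mul_smul_comm]

theorem ofReal {p q : ℝ → ℝ} (h : sys.IsSolution p q) :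
    sys.IsSolution (fun t => (p t : 𝕜)) (fun t => (q t : 𝕜)) := by
  intro t ht
  refine ⟨((RCLike.ofRealCLM (K := 𝕜)).hasFDerivAt.comp_hasDerivWithinAt t
      (h t ht).1).congr_deriv ?_,
    ((RCLike.ofRealCLM (K := 𝕜)).hasFDerivAt.comp_hasDerivWithinAt t (h t ht).2).congr_deriv ?_⟩ <;>
  simp [RCLike.real_smul_eq_coe_mul]

/-- Liouville's formula for the Wronskian. -/
theorem exists_wronskian (h₁ : sys.IsSolution φ₁ ψ₁) (h₂ : sys.IsSolution φ₂ ψ₂) :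
    ∃ C : 𝕜, ∀ t, sys.t₀ ≤ t → φ₁ t * ψ₂ t - φ₂ t * ψ₁ t = C * (sys.JS t : 𝕜) := by
  have hd : ∀ t, sys.t₀ ≤ t → HasDerivWithinAt
      (fun t => (sys.JS t)⁻¹ • (φ₁ t * ψ₂ t - φ₂ t * ψ₁ t)) 0 (Set.Ici sys.t₀) t := by
    intro t ht
    obtain ⟨p₁, q₁⟩ := h₁ t ht
    obtain ⟨p₂, q₂⟩ := h₂ t ht
    refine (((sys.JS_hasDerivWithinAt ht).inv (sys.JS_pos t).ne').smul
      ((p₁.mul q₂).sub (p₂.mul q₁))).congr_deriv ?_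
    have hJ : (sys.JS t : 𝕜) ≠ 0 := by exact_mod_cast (sys.JS_pos t).ne'
    simp only [RCLike.real_smul_eq_coe_mul, Pi.inv_apply, Pi.sub_apply, Pi.mul_apply]
    push_cast
    field_simp
    ring
  refine ⟨(sys.JS sys.t₀)⁻¹ • (φ₁ sys.t₀ * ψ₂ sys.t₀ - φ₂ sys.t₀ * ψ₁ sys.t₀), fun t ht => ?_⟩
  have hJ : (sys.JS t : 𝕜) ≠ 0 := by exact_mod_cast (sys.JS_pos t).ne'
  have := eq_of_hasDerivWithinAt_Ici_zero hd ht
  rw [← this, RCLike.real_smul_eq_coe_mul]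
  push_cast
  field_simp

/-- A real solution that vanishes at some time vanishes at all later times. -/
theorem eq_zero_of_eq_zero {p q : ℝ → ℝ} (h : sys.IsSolution p q) {s t : ℝ} (hs : sys.t₀ ≤ s)
    (hst : s ≤ t) (hp : p s = 0) (hq : q s = 0) : p t = 0 ∧ q t = 0 := by
  have hsub : Set.Icc s t ⊆ Set.Ici sys.t₀ := fun y hy => hs.trans hy.1
  have hK : ContinuousOn (fun τ => |sys.a₁₁ τ| + |sys.a₁₂ τ| + |sys.a₂₁ τ| + |sys.a₂₂ τ|)
      (Set.Icc s t) :=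
    (((sys.cont₁₁.abs.add sys.cont₁₂.abs).add sys.cont₂₁.abs).add sys.cont₂₂.abs).mono hsub
  obtain ⟨K, hK⟩ := isCompact_Icc.exists_bound_of_continuousOn hK
  -- Grönwall for the vector `(p, q)` in the sup norm, with zero initial value.
  have hz := norm_le_gronwallBound_of_norm_deriv_right_le (f := fun τ => (p τ, q τ))
    (f' := fun τ => (sys.a₁₁ τ • p τ + sys.a₁₂ τ • q τ, sys.a₂₁ τ • p τ + sys.a₂₂ τ • q τ))
    (δ := 0) (K := K) (ε := 0) (a := s) (b := t)
    ((h.continuousOn_fst.mono hsub).prodMk (h.continuousOn_snd.mono hsub))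
    (fun τ hτ => ((h τ (hs.trans hτ.1)).1.prodMk (h τ (hs.trans hτ.1)).2).mono
      fun y hy => hs.trans (hτ.1.trans hy))
    (by simp [hp, hq])
    (by
      intro τ hτ
      have hb := (le_abs_self _).trans (hK τ ⟨hτ.1, hτ.2.le⟩)
      have h1 : |p τ| ≤ ‖(p τ, q τ)‖ := norm_fst_le (p τ, q τ)
      have h2 : |q τ| ≤ ‖(p τ, q τ)‖ := norm_snd_le (p τ, q τ)
      have h0 := norm_nonneg (p τ, q τ)
      have key : ∀ b c : ℝ, |b| + |c| ≤ K → |b * p τ + c * q τ| ≤ K * ‖(p τ, q τ)‖ := by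
        intro b c hbc
        calc |b * p τ + c * q τ| ≤ |b| * |p τ| + |c| * |q τ| := by
              simpa only [abs_mul] using abs_add_le (b * p τ) (c * q τ)
          _ ≤ |b| * ‖(p τ, q τ)‖ + |c| * ‖(p τ, q τ)‖ := by gcongr
          _ = (|b| + |c|) * ‖(p τ, q τ)‖ := by ring
          _ ≤ K * ‖(p τ, q τ)‖ := by gcongr
      have p1 := abs_nonneg (sys.a₁₁ τ)
      have p2 := abs_nonneg (sys.a₁₂ τ)
      have p3 := abs_nonneg (sys.a₂₁ τ)
      have p4 := abs_nonneg (sys.a₂₂ τ)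
      rw [add_zero]
      exact max_le (key _ _ (by linarith)) (key _ _ (by linarith))) t ⟨hst, le_rfl⟩
  rw [gronwallBound_ε0, zero_mul] at hz
  have := norm_le_zero_iff.1 hz
  exact ⟨congrArg Prod.fst this, congrArg Prod.snd this⟩

/-- Reduction of order: a real solution that never vanishes as a vector is completed to a
fundamental pair by a quadrature. -/
theorem exists_second_solution {p q : ℝ → ℝ} (h : sys.IsSolution p q)
    (hN : ∀ t, sys.t₀ ≤ t → p t ^ 2 + q t ^ 2 ≠ 0) :
    ∃ u v : ℝ → ℝ, sys.IsSolution u v ∧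
      ∀ t, sys.t₀ ≤ t → p t * v t - u t * q t = sys.JS t := by
  have hp := h.continuousOn_fst
  have hq := h.continuousOn_snd
  -- The second solution is sought as `α (p, q) + β (-q, p)`, since `p` may vanish before `t₁` and
  -- cannot be divided by. The Wronskian condition forces `β = J_S / (p² + q²)`; the system then
  -- prescribes `α' = g`.
  set g : ℝ → ℝ := fun t => sys.JS t / (p t ^ 2 + q t ^ 2) ^ 2 *
    ((sys.a₁₂ t + sys.a₂₁ t) * (p t ^ 2 - q t ^ 2) + 2 * (sys.a₂₂ t - sys.a₁₁ t) * (p t * q t))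
    with hgdef
  have hg : ContinuousOn g (Set.Ici sys.t₀) := by
    refine (sys.JS_continuousOn.div (((hp.pow 2).add (hq.pow 2)).pow 2)
      fun t ht => pow_ne_zero 2 (hN t ht)).mul ?_
    exact ((sys.cont₁₂.add sys.cont₂₁).mul ((hp.pow 2).sub (hq.pow 2))).add
      ((continuousOn_const.mul (sys.cont₂₂.sub sys.cont₁₁)).mul (hp.mul hq))
  set α : ℝ → ℝ := fun t => ∫ τ in sys.t₀..t, g τ
  set β : ℝ → ℝ := fun t => sys.JS t / (p t ^ 2 + q t ^ 2) with hβdef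
  refine ⟨fun t => α t * p t - β t * q t, fun t => α t * q t + β t * p t, fun t ht => ?_,
    fun t ht => ?_⟩
  · have hα : HasDerivWithinAt α (g t) (Set.Ici sys.t₀) t := hasDerivWithinAt_integral_Ici hg ht
    obtain ⟨dp, dq⟩ := h t ht
    have hβ := (sys.JS_hasDerivWithinAt ht).div ((dp.pow 2).add (dq.pow 2)) (hN t ht)
    have hn := hN t ht
    refine ⟨((hα.mul dp).sub (hβ.mul dq)).congr_deriv ?_,
      ((hα.mul dq).add (hβ.mul dp)).congr_deriv ?_⟩
    all_goals
      simp only [smul_eq_mul, hgdef, hβdef, Pi.add_apply, Pi.pow_apply, Pi.div_apply]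
      field_simp
      ring
  · have hn := hN t ht
    simp only [hβdef]
    field_simp
    ring

/-- If `(w, w')` has Wronskian `C * J_S` with `(φ, ψ)`, then `w / φ` is an antiderivative of
`C * a₁₂ * J_S / φ²`. -/
theorem mul_partialIntegral {w w' : ℝ → 𝕜} {C : 𝕜} {s t : ℝ} (h : sys.IsSolution φ ψ)
    (hw : sys.IsSolution w w')
    (hC : ∀ t, sys.t₀ ≤ t → φ t * w' t - w t * ψ t = C * (sys.JS t : 𝕜)) (hs : sys.t₀ ≤ s)
    (hφ : ∀ t, s ≤ t → φ t ≠ 0) (hst : s ≤ t) :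
    C * sys.partialIntegral φ s t = w t / φ t - w s / φ s := by
  have hsub : Set.Ici s ⊆ Set.Ici sys.t₀ := Set.Ici_subset_Ici.2 hs
  have hd : ∀ τ, s ≤ τ → HasDerivWithinAt (fun x => w x / φ x)
      (C * (sys.a₁₂ τ * sys.JS τ) • ((φ τ) ^ 2)⁻¹) (Set.Ici s) τ := by
    intro τ hτ
    have h0 := hφ τ hτ
    refine (((hw τ (hs.trans hτ)).1.div (h τ (hs.trans hτ)).1 h0).mono hsub).congr_deriv ?_
    have hc := hC τ (hs.trans hτ)
    simp only [RCLike.real_smul_eq_coe_mul]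
    push_cast
    field_simp
    linear_combination (sys.a₁₂ τ : 𝕜) * hc
  have hcont : ContinuousOn (fun τ => C * (sys.a₁₂ τ * sys.JS τ) • ((φ τ) ^ 2)⁻¹) (Set.Ici s) :=
    continuousOn_const.mul (((sys.cont₁₂.mul sys.JS_continuousOn).mono hsub).smul
      (((h.continuousOn_fst.mono hsub).pow 2).inv₀ fun τ hτ => pow_ne_zero 2 (hφ τ hτ)))
  rw [← integral_eq_sub_of_hasDerivWithinAt_Ici hd hcont le_rfl hst, partialIntegral,
    intervalIntegral.integral_const_mul]

end IsSolution

/-! ### Dominated fundamental pairs -/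

theorem linIndep_of_wronskian_ne_zero {𝕜 : Type*} [RCLike 𝕜] {φ₁ ψ₁ φ₂ ψ₂ : ℝ → 𝕜} {t : ℝ}
    (ht : sys.t₀ ≤ t) (hW : φ₁ t * ψ₂ t - φ₂ t * ψ₁ t ≠ 0) : sys.LinIndep φ₁ ψ₁ φ₂ ψ₂ := by
  intro c₁ c₂ hc
  obtain ⟨h1, h2⟩ := hc t ht
  constructor
  · refine (mul_eq_zero.1 (?_ : c₁ * (φ₁ t * ψ₂ t - φ₂ t * ψ₁ t) = 0)).resolve_right hW
    linear_combination ψ₂ t * h1 - φ₂ t * h2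
  · refine (mul_eq_zero.1 (?_ : c₂ * (φ₁ t * ψ₂ t - φ₂ t * ψ₁ t) = 0)).resolve_right hW
    linear_combination φ₁ t * h2 - ψ₁ t * h1

variable (sys) in
/-- A fundamental pair of real solutions, without zeros in the first components on `[t₁, ∞)`, the
second of which is negligible at infinity compared to the first. -/
structure IsDominatedPair (t₁ : ℝ) (φ ψ u v : ℝ → ℝ) : Prop where
  le : sys.t₀ ≤ t₁
  sol₁ : sys.IsSolution φ ψ
  sol₂ : sys.IsSolution u v
  ne_zero₁ : ∀ t, t₁ ≤ t → φ t ≠ 0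
  ne_zero₂ : ∀ t, t₁ ≤ t → u t ≠ 0
  wronskian : ∀ t, sys.t₀ ≤ t → φ t * v t - u t * ψ t = -sys.JS t
  tendsto : Tendsto (fun t => u t / φ t) atTop (𝓝 0)

theorem IsRegularFrom.exists_isDominatedPair {t₁ : ℝ} (ht₁ : sys.t₀ ≤ t₁) {φ ψ : ℝ → ℝ}
    (h : sys.IsRegularFrom t₁ φ ψ)
    (hL : ∀ t, t₁ ≤ t → ∃ L : ℝ, L ≠ 0 ∧ Tendsto (sys.partialIntegral φ t) atTop (𝓝 L)) :
    ∃ u v, sys.IsDominatedPair t₁ φ ψ u v := by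
  obtain ⟨hsol, hne⟩ := h
  -- A zero of the whole vector would propagate forward into `[t₁, ∞)`, where `φ ≠ 0`.
  have hN : ∀ t, sys.t₀ ≤ t → φ t ^ 2 + ψ t ^ 2 ≠ 0 := by
    intro t ht h0
    have h1 : φ t = 0 := by nlinarith [sq_nonneg (φ t), sq_nonneg (ψ t)]
    have h2 : ψ t = 0 := by nlinarith [sq_nonneg (φ t), sq_nonneg (ψ t)]
    exact hne _ (le_max_right t t₁) (hsol.eq_zero_of_eq_zero ht (le_max_left t t₁) h1 h2).1
  obtain ⟨y, y', hy, hW⟩ := hsol.exists_second_solution hN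
  have hI : ∀ s, t₁ ≤ s → ∀ t, s ≤ t → sys.partialIntegral φ s t = y t / φ t - y s / φ s := by
    intro s hs t hst
    have := hsol.mul_partialIntegral (C := 1) hy (fun t ht => by simp [hW t ht])
      (ht₁.trans hs) (fun t ht => hne t (hs.trans ht)) hst
    rwa [one_mul] at this
  obtain ⟨L, -, hlim⟩ := hL t₁ le_rfl
  have hy_lim : Tendsto (fun t => y t / φ t) atTop (𝓝 (L + y t₁ / φ t₁)) := by
    refine (hlim.add_const (y t₁ / φ t₁)).congr' ?_
    filter_upwards [eventually_ge_atTop t₁] with t ht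
    rw [hI t₁ le_rfl t ht, sub_add_cancel]
  set c := L + y t₁ / φ t₁
  refine ⟨fun t => c * φ t + (-1) * y t, fun t => c * ψ t + (-1) * y' t, ht₁, hsol,
    (hsol.const_mul c).add (hy.const_mul (-1)), hne, fun t ht h0 => ?_, fun t ht => ?_, ?_⟩
  -- A zero of `c φ - y` at `t` would make the tail integral from `t` vanish.
  · obtain ⟨L', hL', hlim'⟩ := hL t ht
    have h1 : Tendsto (sys.partialIntegral φ t) atTop (𝓝 (c - y t / φ t)) := by
      refine (hy_lim.sub_const (y t / φ t)).congr' ?_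
      filter_upwards [eventually_ge_atTop t] with s hs
      rw [hI t ht s hs]
    refine hL' (tendsto_nhds_unique hlim' h1 |>.trans ?_)
    have := hne t ht
    field_simp
    linear_combination h0
  · linear_combination -hW t ht
  · have h1 : Tendsto (fun t => c - y t / φ t) atTop (𝓝 (c - c)) := hy_lim.const_sub c
    rw [sub_self] at h1
    refine h1.congr' ?_
    filter_upwards [eventually_ge_atTop t₁] with t ht
    have := hne t ht
    field_simp
    ring

namespace IsDominatedPair

variable {t₁ : ℝ} {φ ψ u v : ℝ → ℝ}

/-- Cramer's rule: the coefficients are ratios of Wronskians, constant by Liouville's formula. -/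
theorem exists_eq_combination {𝕜 : Type*} [RCLike 𝕜] (P : sys.IsDominatedPair t₁ φ ψ u v)
    {z w : ℝ → 𝕜} (hz : sys.IsSolution z w) :
    ∃ α β : 𝕜, ∀ t, sys.t₀ ≤ t →
      z t = α * (φ t : 𝕜) + β * (u t : 𝕜) ∧ w t = α * (ψ t : 𝕜) + β * (v t : 𝕜) := by
  obtain ⟨C₁, h₁⟩ := hz.exists_wronskian (P.sol₂.ofReal (𝕜 := 𝕜))
  obtain ⟨C₂, h₂⟩ := (P.sol₁.ofReal (𝕜 := 𝕜)).exists_wronskian hz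
  refine ⟨-C₁, -C₂, fun t ht => ?_⟩
  have hJ : (sys.JS t : 𝕜) ≠ 0 := by exact_mod_cast (sys.JS_pos t).ne'
  have hW : (φ t : 𝕜) * (v t : 𝕜) - (u t : 𝕜) * (ψ t : 𝕜) = -(sys.JS t : 𝕜) := by
    exact_mod_cast P.wronskian t ht
  have e₁ := h₁ t ht
  have e₂ := h₂ t ht
  constructor
  · apply mul_left_cancel₀ hJ
    linear_combination z t * hW - (φ t : 𝕜) * e₁ - (u t : 𝕜) * e₂
  · apply mul_left_cancel₀ hJ
    linear_combination w t * hW - (ψ t : 𝕜) * e₁ - (v t : 𝕜) * e₂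

section Combination

variable {𝕜 : Type*} [RCLike 𝕜] {z w : ℝ → 𝕜} {α β : 𝕜}

theorem tendsto_div (P : sys.IsDominatedPair t₁ φ ψ u v)
    (hz : ∀ t, sys.t₀ ≤ t → z t = α * (φ t : 𝕜) + β * (u t : 𝕜)) :
    Tendsto (fun t => z t / (φ t : 𝕜)) atTop (𝓝 α) := by
  have h1 : Tendsto (fun t => ((u t / φ t : ℝ) : 𝕜)) atTop (𝓝 ((0 : ℝ) : 𝕜)) :=
    (RCLike.continuous_ofReal.tendsto 0).comp P.tendsto
  have h2 := (h1.const_mul β).const_add α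
  rw [RCLike.ofReal_zero, mul_zero, add_zero] at h2
  refine h2.congr' ?_
  filter_upwards [eventually_ge_atTop t₁] with t ht
  have h0 : (φ t : 𝕜) ≠ 0 := by exact_mod_cast P.ne_zero₁ t ht
  rw [hz t (P.le.trans ht)]
  push_cast
  field_simp

theorem eventually_ne_zero (P : sys.IsDominatedPair t₁ φ ψ u v)
    (hz : ∀ t, sys.t₀ ≤ t → z t = α * (φ t : 𝕜) + β * (u t : 𝕜)) (hα : α ≠ 0) :
    ∀ᶠ t in atTop, z t ≠ 0 := by
  filter_upwards [(P.tendsto_div hz).eventually_ne hα] with t ht h0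
  exact ht (by rw [h0, zero_div])

theorem tendsto_second_div (P : sys.IsDominatedPair t₁ φ ψ u v)
    (hz : ∀ t, sys.t₀ ≤ t → z t = α * (φ t : 𝕜) + β * (u t : 𝕜)) (hα : α ≠ 0) :
    Tendsto (fun t => (u t : 𝕜) / z t) atTop (𝓝 0) := by
  have h1 : Tendsto (fun t => (u t : 𝕜) / (φ t : 𝕜)) atTop (𝓝 0) :=
    P.tendsto_div (β := 1) fun t _ => by simp
  have h2 := h1.div (P.tendsto_div hz) hα
  rw [zero_div] at h2
  refine h2.congr' ?_
  filter_upwards [eventually_ge_atTop t₁] with t ht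
  have h0 : (φ t : 𝕜) ≠ 0 := by exact_mod_cast P.ne_zero₁ t ht
  exact div_div_div_cancel_right₀ h0 _ _

/-- If `α = 0`, then `b z - β m = 0` is a relation with `b ≠ 0`. -/
theorem coeff_ne_zero {b : ℝ} {m n : ℝ → ℝ}
    (hz : ∀ t, sys.t₀ ≤ t →
      z t = α * (φ t : 𝕜) + β * (u t : 𝕜) ∧ w t = α * (ψ t : 𝕜) + β * (v t : 𝕜))
    (hb : b ≠ 0) (hm : ∀ t, sys.t₀ ≤ t → m t = b * u t ∧ n t = b * v t)
    (hi : sys.LinIndep z w (fun t => (m t : 𝕜)) (fun t => (n t : 𝕜))) : α ≠ 0 := by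
  rintro rfl
  have := (hi (b : 𝕜) (-β) fun t ht => by
    simp only [(hz t ht).1, (hz t ht).2, (hm t ht).1, (hm t ht).2]
    push_cast
    constructor <;> ring).1
  exact hb (by exact_mod_cast this)

theorem isRegularSolution (P : sys.IsDominatedPair t₁ φ ψ u v) (hsol : sys.IsSolution z w)
    (hz : ∀ t, sys.t₀ ≤ t → z t = α * (φ t : 𝕜) + β * (u t : 𝕜)) (hα : α ≠ 0) :
    sys.IsRegularSolution z w := by
  obtain ⟨T, hT⟩ := eventually_atTop.1 (P.eventually_ne_zero hz hα)
  exact ⟨max sys.t₀ T, le_max_left _ _, hsol, fun t ht => hT t ((le_max_right _ _).trans ht)⟩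

theorem exists_tendsto_partialIntegral (P : sys.IsDominatedPair t₁ φ ψ u v)
    (hsol : sys.IsSolution z w)
    (hz : ∀ t, sys.t₀ ≤ t →
      z t = α * (φ t : 𝕜) + β * (u t : 𝕜) ∧ w t = α * (ψ t : 𝕜) + β * (v t : 𝕜))
    (hα : α ≠ 0) {T : ℝ} (hT : sys.t₀ ≤ T) (hne : ∀ t, T ≤ t → z t ≠ 0) :
    ∃ L : 𝕜, Tendsto (sys.partialIntegral z T) atTop (𝓝 L) := by
  -- The Wronskian of `z` and `u` is `-α J_S`, so `u / z` is an antiderivative of `-α a₁₂ J_S / z²`.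
  refine ⟨-α⁻¹ * (0 - u T / z T), (((P.tendsto_second_div (fun t ht => (hz t ht).1) hα).sub_const
    ((u T : 𝕜) / z T)).const_mul (-α⁻¹)).congr' ?_⟩
  filter_upwards [eventually_ge_atTop T] with t ht
  rw [← hsol.mul_partialIntegral (C := -α) (P.sol₂.ofReal (𝕜 := 𝕜)) ?_ hT hne ht]
  · field_simp
  · intro s hs
    have hW : (φ s : 𝕜) * (v s : 𝕜) - (u s : 𝕜) * (ψ s : 𝕜) = -(sys.JS s : 𝕜) := by
      exact_mod_cast P.wronskian s hs
    rw [(hz s hs).1, (hz s hs).2]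
    linear_combination α * hW

/-- If `z` were bounded near infinity, so would be `φ`, as `φ / z → α⁻¹`. With `|φ| ≤ B`, `|a₁₂| J_S
≤ B² |a₁₂| J_S / φ²`, whose integral converges because `a₁₂` has one sign. -/
theorem limsup_norm_eq_top (P : sys.IsDominatedPair t₁ φ ψ u v)
    (hz : ∀ t, sys.t₀ ≤ t → z t = α * (φ t : 𝕜) + β * (u t : 𝕜)) (hα : α ≠ 0)
    (hsign : (∀ t, sys.t₀ ≤ t → 0 ≤ sys.a₁₂ t) ∨ (∀ t, sys.t₀ ≤ t → sys.a₁₂ t ≤ 0))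
    (hdiv : Tendsto (fun t => ∫ τ in sys.t₀..t, |sys.a₁₂ τ * sys.JS τ|) atTop atTop) :
    limsup (fun t => ((‖z t‖ : ℝ) : EReal)) atTop = ⊤ := by
  by_contra hne
  obtain ⟨M, hM, -⟩ := EReal.lt_iff_exists_real_btwn.1 (lt_top_iff_ne_top.2 hne)
  have hzM : ∀ᶠ t in atTop, ‖z t‖ < M := by
    filter_upwards [eventually_lt_of_limsup_lt hM] with t ht
    exact_mod_cast ht
  have hinv : Tendsto (fun t => ‖(z t / (φ t : 𝕜))⁻¹‖) atTop (𝓝 ‖α⁻¹‖) :=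
    ((P.tendsto_div hz).inv₀ hα).norm
  set B := (‖α⁻¹‖ + 1) * M
  have hφB : ∀ᶠ t in atTop, |φ t| ≤ B := by
    filter_upwards [hzM, hinv.eventually_lt_const (lt_add_one _), P.eventually_ne_zero hz hα]
      with t h1 h2 h3
    have h4 : |φ t| = ‖(z t / (φ t : 𝕜))⁻¹‖ * ‖z t‖ := by
      rw [← norm_mul, inv_div, div_mul_cancel₀ _ h3, RCLike.norm_ofReal]
    rw [h4]
    exact mul_le_mul h2.le h1.le (norm_nonneg _) (by positivity)
  obtain ⟨T, hT⟩ := eventually_atTop.1 (hφB.and (eventually_ge_atTop t₁))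
  have hT₁ : t₁ ≤ T := (hT T le_rfl).2
  have hT₀ : sys.t₀ ≤ T := P.le.trans hT₁
  obtain ⟨ε, hε, hεa⟩ : ∃ ε : ℝ, |ε| = 1 ∧ ∀ t, sys.t₀ ≤ t → |sys.a₁₂ t| = ε * sys.a₁₂ t := by
    rcases hsign with h | h
    · exact ⟨1, by simp, fun t ht => by rw [abs_of_nonneg (h t ht), one_mul]⟩
    · exact ⟨-1, by simp, fun t ht => by rw [abs_of_nonpos (h t ht), neg_one_mul]⟩
  obtain ⟨L, hL⟩ := P.exists_tendsto_partialIntegral (𝕜 := ℝ) (α := 1) (β := 0) P.sol₁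
    (fun t _ => by simp) one_ne_zero hT₀ (fun t ht => P.ne_zero₁ t (hT₁.trans ht))
  have hlim := (hL.const_mul (B ^ 2 * ε)).const_add (∫ τ in sys.t₀..T, |sys.a₁₂ τ * sys.JS τ|)
  refine not_tendsto_atTop_of_tendsto_nhds hlim (tendsto_atTop_mono' _ ?_ hdiv)
  filter_upwards [eventually_ge_atTop T] with t ht
  have hc : ContinuousOn (fun τ => sys.a₁₂ τ * sys.JS τ) (Set.Ici sys.t₀) :=
    sys.cont₁₂.mul sys.JS_continuousOn
  have hint : ∀ a b, sys.t₀ ≤ a → a ≤ b → IntervalIntegrable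
      (fun τ => |sys.a₁₂ τ * sys.JS τ|) MeasureTheory.volume a b := by
    intro a b ha hab
    refine (hc.abs.mono fun y hy => ?_).intervalIntegrable
    rw [Set.uIcc_of_le hab] at hy
    exact ha.trans hy.1
  rw [← intervalIntegral.integral_add_adjacent_intervals (hint _ _ le_rfl hT₀) (hint _ _ hT₀ ht),
    partialIntegral, ← intervalIntegral.integral_const_mul]
  refine add_le_add le_rfl (intervalIntegral.integral_mono_on ht (hint _ _ hT₀ ht) ?_ ?_)
  · refine ContinuousOn.intervalIntegrable ?_
    rw [Set.uIcc_of_le ht]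
    have hsub : Set.Icc T t ⊆ Set.Ici sys.t₀ := fun y hy => hT₀.trans hy.1
    exact continuousOn_const.mul ((hc.mono hsub).smul
      (((P.sol₁.continuousOn_fst.mono hsub).pow 2).inv₀
        fun y hy => pow_ne_zero 2 (P.ne_zero₁ y (hT₁.trans hy.1))))
  · intro τ hτ
    have h1 := hεa τ (hT₀.trans hτ.1)
    have h2 : φ τ ^ 2 ≤ B ^ 2 := sq_le_sq.2 ((hT τ hτ.1).1.trans (le_abs_self B))
    have h3 : 0 < φ τ ^ 2 := by
      have := P.ne_zero₁ τ (hT₁.trans hτ.1)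
      positivity
    have h4 := sys.JS_pos τ
    calc |sys.a₁₂ τ * sys.JS τ| = |sys.a₁₂ τ| * sys.JS τ := by rw [abs_mul, abs_of_pos h4]
      _ ≤ (|sys.a₁₂ τ| * sys.JS τ) * (B ^ 2 * (φ τ ^ 2)⁻¹) := by
          refine le_mul_of_one_le_right (by positivity) ?_
          rw [← div_eq_mul_inv]
          exact (one_le_div h3).2 h2
      _ = B ^ 2 * ε * (sys.a₁₂ τ * sys.JS τ) • (φ τ ^ 2)⁻¹ := by
          rw [h1, smul_eq_mul]
          ring

end Combination

theorem exists_tendsto_div (P : sys.IsDominatedPair t₁ φ ψ u v) {z₁ z₂ : ℝ → ℝ}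
    {α₁ β₁ α₂ β₂ : ℝ} (h₁ : ∀ t, sys.t₀ ≤ t → z₁ t = α₁ * φ t + β₁ * u t)
    (h₂ : ∀ t, sys.t₀ ≤ t → z₂ t = α₂ * φ t + β₂ * u t) (hα₁ : α₁ ≠ 0) (hα₂ : α₂ ≠ 0) :
    ∃ L : ℝ, L ≠ 0 ∧ Tendsto (fun t => z₁ t / z₂ t) atTop (𝓝 L) := by
  refine ⟨α₁ / α₂, div_ne_zero hα₁ hα₂,
    ((P.tendsto_div (𝕜 := ℝ) h₁).div (P.tendsto_div (𝕜 := ℝ) h₂) hα₂).congr' ?_⟩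
  filter_upwards [eventually_ge_atTop t₁] with t ht
  exact div_div_div_cancel_right₀ (P.ne_zero₁ t ht) _ _

/-! ### Minimal solutions and extremality -/

theorem isMinimalSolution (P : sys.IsDominatedPair t₁ φ ψ u v) : sys.IsMinimalSolution u v := by
  refine ⟨⟨t₁, P.le, P.sol₂, P.ne_zero₂⟩, fun z w hz hi => ?_⟩
  obtain ⟨_, _, hsol, _⟩ := hz
  obtain ⟨α, β, hαβ⟩ := P.exists_eq_combination hsol
  exact P.tendsto_second_div (𝕜 := ℝ) (fun t ht => (hαβ t ht).1)
    (coeff_ne_zero (b := 1) hαβ one_ne_zero (fun t _ => by simp) hi)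

theorem isExtremal (P : sys.IsDominatedPair t₁ φ ψ u v) : sys.IsExtremal := by
  refine ⟨?_, u, v, P.isMinimalSolution⟩
  rintro ⟨z, w, -, huniq⟩
  obtain ⟨c₁, h₁⟩ := huniq φ ψ ⟨t₁, P.le, P.sol₁, P.ne_zero₁⟩
  obtain ⟨c₂, h₂⟩ := huniq u v ⟨t₁, P.le, P.sol₂, P.ne_zero₂⟩
  have hW := P.wronskian sys.t₀ le_rfl
  have := sys.JS_pos sys.t₀
  -- Were both pairs multiples of `(z, w)`, their Wronskian would be zero.
  rw [(h₁ _ le_rfl).1, (h₁ _ le_rfl).2, (h₂ _ le_rfl).1, (h₂ _ le_rfl).2] at hW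
  linarith

theorem eq_const_mul_of_isMinimalSolution (P : sys.IsDominatedPair t₁ φ ψ u v) {m n : ℝ → ℝ}
    (hm : sys.IsMinimalSolution m n) :
    ∃ b : ℝ, b ≠ 0 ∧ ∀ t, sys.t₀ ≤ t → m t = b * u t ∧ n t = b * v t := by
  obtain ⟨⟨T, hT, hsol, hne⟩, hmin⟩ := hm
  obtain ⟨α, β, h⟩ := P.exists_eq_combination hsol
  simp only [RCLike.ofReal_real_eq_id, id] at h
  have hα : α = 0 := by
    -- With `α ≠ 0`, minimality of `m` gives `m / u → 0` while domination gives `u / m → 0`, yet the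
    -- product is `1`.
    by_contra hα
    have hi : sys.LinIndep u v m n := by
      refine linIndep_of_wronskian_ne_zero (t := sys.t₀) le_rfl ?_
      have : u sys.t₀ * n sys.t₀ - m sys.t₀ * v sys.t₀ = α * sys.JS sys.t₀ := by
        rw [(h _ le_rfl).1, (h _ le_rfl).2]
        linear_combination -α * P.wronskian _ le_rfl
      rw [this]
      exact mul_ne_zero hα (sys.JS_pos _).ne'
    have h1 := (hmin u v ⟨t₁, P.le, P.sol₂, P.ne_zero₂⟩ hi).mul
      (P.tendsto_second_div (𝕜 := ℝ) (fun t ht => (h t ht).1) hα)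
    rw [zero_mul] at h1
    refine one_ne_zero (tendsto_nhds_unique (h1.congr' ?_) (tendsto_const_nhds (x := (1 : ℝ)))).symm
    filter_upwards [eventually_ge_atTop t₁, eventually_ge_atTop T] with t ht ht'
    have := P.ne_zero₂ t ht
    have := hne t ht'
    simp only [RCLike.ofReal_real_eq_id, id]
    field_simp
  subst hα
  refine ⟨β, ?_, fun t ht => by simpa using h t ht⟩
  rintro rfl
  exact hne T le_rfl (by simpa using (h T hT).1)

/-- Up to an additive constant the integral is the reciprocal of `b m / φ`, which tends to `0` and,
being continuous without zeros on `[t₁, ∞)`, keeps its sign. -/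
theorem tendsto_partialIntegral_infinite (P : sys.IsDominatedPair t₁ φ ψ u v) {m n : ℝ → ℝ} {b : ℝ}
    (hsol : sys.IsSolution m n) (hb : b ≠ 0)
    (hm : ∀ t, sys.t₀ ≤ t → m t = b * u t ∧ n t = b * v t) :
    Tendsto (sys.partialIntegral m t₁) atTop atTop ∨
      Tendsto (sys.partialIntegral m t₁) atTop atBot := by
  have hne : ∀ t, t₁ ≤ t → m t ≠ 0 := fun t ht => by
    rw [(hm t (P.le.trans ht)).1]
    exact mul_ne_zero hb (P.ne_zero₂ t ht)
  have hI : ∀ t, t₁ ≤ t →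
      (φ t / m t) * b⁻¹ - φ t₁ / m t₁ * b⁻¹ = sys.partialIntegral m t₁ t := by
    intro t ht
    rw [← sub_mul, ← hsol.mul_partialIntegral (C := b) P.sol₁ ?_ P.le hne ht]
    · field_simp
    · intro s hs
      rw [(hm s hs).1, (hm s hs).2]
      simp only [RCLike.ofReal_real_eq_id, id]
      linear_combination -b * P.wronskian s hs
  have hlim : Tendsto (fun t => m t / φ t * b) atTop (𝓝 0) := by
    have := P.tendsto.const_mul (b * b)
    rw [mul_zero] at this
    refine this.congr' ?_
    filter_upwards [eventually_ge_atTop t₁] with t ht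
    rw [(hm t (P.le.trans ht)).1]
    ring
  have hcont : ContinuousOn (fun t => m t / φ t * b) (Set.Ici t₁) :=
    ((hsol.continuousOn_fst.mono (Set.Ici_subset_Ici.2 P.le)).div
      (P.sol₁.continuousOn_fst.mono (Set.Ici_subset_Ici.2 P.le)) P.ne_zero₁).mul continuousOn_const
  have hnz : ∀ t, t₁ ≤ t → m t / φ t * b ≠ 0 := fun t ht =>
    mul_ne_zero (div_ne_zero (hne t ht) (P.ne_zero₁ t ht)) hb
  have hsign : (∀ t, t₁ ≤ t → 0 < m t / φ t * b) ∨ (∀ t, t₁ ≤ t → m t / φ t * b < 0) := by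
    by_contra! hcon
    obtain ⟨⟨s, hs, hs'⟩, r, hr, hr'⟩ := hcon
    obtain ⟨c, hc, hc0⟩ := isPreconnected_Ici.intermediate_value (Set.mem_Ici.2 hs)
      (Set.mem_Ici.2 hr) hcont ⟨hs', hr'⟩
    exact hnz c hc hc0
  have hev : (fun t => (m t / φ t * b)⁻¹ + -(φ t₁ / m t₁ * b⁻¹)) =ᶠ[atTop]
      sys.partialIntegral m t₁ := by
    filter_upwards [eventually_ge_atTop t₁] with t ht
    rw [← hI t ht, mul_inv, inv_div, sub_eq_add_neg]
  rcases hsign with h | h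
  · left
    refine (tendsto_atTop_add_const_right _ _ (Tendsto.comp tendsto_inv_nhdsGT_zero
      (tendsto_nhdsWithin_iff.2 ⟨hlim, ?_⟩))).congr' hev
    filter_upwards [eventually_ge_atTop t₁] with t ht using h t ht
  · right
    refine (tendsto_atBot_add_const_right _ _ (Tendsto.comp tendsto_inv_nhdsLT_zero
      (tendsto_nhdsWithin_iff.2 ⟨hlim, ?_⟩))).congr' hev
    filter_upwards [eventually_ge_atTop t₁] with t ht using h t ht

end IsDominatedPair

end PlanarSystem

theorem theorem3p5 (sys : PlanarSystem) (t₁ : ℝ) (ht₁ : sys.t₀ ≤ t₁)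
    -- a real valued `t₁`-regular solution with `∫_t^∞ a₁₂ J_S / φ₀²` convergent and nonzero
    (hreg : ∃ φ₀ ψ₀ : ℝ → ℝ, sys.IsRegularFrom t₁ φ₀ ψ₀ ∧
      ∀ t, t₁ ≤ t → ∃ L : ℝ, L ≠ 0 ∧ Tendsto (sys.partialIntegral φ₀ t) atTop (𝓝 L)) :
    -- a) the system is extremal, its minimal solution is unique up to a multiplier
    sys.IsExtremal ∧
    (∀ φ ψ φ' ψ' : ℝ → ℝ, sys.IsMinimalSolution φ ψ → sys.IsMinimalSolution φ' ψ' →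
      ∃ c : ℝ, c ≠ 0 ∧ ∀ t, sys.t₀ ≤ t → φ' t = c * φ t ∧ ψ' t = c * ψ t) ∧
    ∀ φm ψm : ℝ → ℝ, sys.IsMinimalSolution φm ψm →
      -- a) the minimal solution is `t₁`-regular and its integral is `+∞` or `-∞`
      (sys.IsRegularFrom t₁ φm ψm ∧
        (Tendsto (sys.partialIntegral φm t₁) atTop atTop ∨
          Tendsto (sys.partialIntegral φm t₁) atTop atBot)) ∧
      -- b) every (real or complex) solution linearly independent of the minimal one
      (∀ (𝕜 : Type) [RCLike 𝕜] (φ ψ : ℝ → 𝕜), sys.IsSolution φ ψ →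
        sys.LinIndep φ ψ (fun t => (φm t : 𝕜)) (fun t => (ψm t : 𝕜)) →
        sys.IsRegularSolution φ ψ ∧
        (∀ T, sys.t₀ ≤ T → (∀ t, T ≤ t → φ t ≠ 0) →
          ∃ L : 𝕜, Tendsto (sys.partialIntegral φ T) atTop (𝓝 L)) ∧
        (((∀ t, sys.t₀ ≤ t → 0 ≤ sys.a₁₂ t) ∨ (∀ t, sys.t₀ ≤ t → sys.a₁₂ t ≤ 0)) →
          Tendsto (fun t => ∫ τ in sys.t₀..t, |sys.a₁₂ τ * sys.JS τ|) atTop atTop →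
          limsup (fun t => ((‖φ t‖ : ℝ) : EReal)) atTop = ⊤)) ∧
      -- c) any two real solutions linearly independent of the minimal one
      (∀ φ₁ ψ₁ φ₂ ψ₂ : ℝ → ℝ, sys.IsSolution φ₁ ψ₁ → sys.IsSolution φ₂ ψ₂ →
        sys.LinIndep φ₁ ψ₁ φm ψm → sys.LinIndep φ₂ ψ₂ φm ψm →
        ∃ L : ℝ, L ≠ 0 ∧ Tendsto (fun t => φ₁ t / φ₂ t) atTop (𝓝 L)) := by
  obtain ⟨φ₀, ψ₀, h₀, hL⟩ := hreg
  obtain ⟨u, v, P⟩ := h₀.exists_isDominatedPair ht₁ hL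
  refine ⟨P.isExtremal, fun φ ψ φ' ψ' h h' => ?_, fun φm ψm hmin => ?_⟩
  · obtain ⟨b, hb, hbu⟩ := P.eq_const_mul_of_isMinimalSolution h
    obtain ⟨b', hb', hbu'⟩ := P.eq_const_mul_of_isMinimalSolution h'
    refine ⟨b' / b, div_ne_zero hb' hb, fun t ht => ?_⟩
    rw [(hbu t ht).1, (hbu t ht).2, (hbu' t ht).1, (hbu' t ht).2]
    constructor <;> field_simp
  obtain ⟨b, hb, hm⟩ := P.eq_const_mul_of_isMinimalSolution hmin
  obtain ⟨⟨_, _, hsol, _⟩, -⟩ := hmin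
  refine ⟨⟨⟨hsol, fun t ht => ?_⟩, P.tendsto_partialIntegral_infinite hsol hb hm⟩,
    fun 𝕜 _ φ ψ hφ hi => ?_, fun φ₁ ψ₁ φ₂ ψ₂ h₁ h₂ hi₁ hi₂ => ?_⟩
  · rw [(hm t (ht₁.trans ht)).1]
    exact mul_ne_zero hb (P.ne_zero₂ t ht)
  · obtain ⟨α, β, hαβ⟩ := P.exists_eq_combination hφ
    have hα : α ≠ 0 := PlanarSystem.IsDominatedPair.coeff_ne_zero hαβ hb hm hi
    have hz := fun t ht => (hαβ t ht).1
    exact ⟨P.isRegularSolution hφ hz hα,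
      fun T hT hne => P.exists_tendsto_partialIntegral hφ hαβ hα hT hne,
      fun hsign hdiv => P.limsup_norm_eq_top hz hα hsign hdiv⟩
  · obtain ⟨α₁, β₁, e₁⟩ := P.exists_eq_combination h₁
    obtain ⟨α₂, β₂, e₂⟩ := P.exists_eq_combination h₂
    exact P.exists_tendsto_div (fun t ht => (e₁ t ht).1) (fun t ht => (e₂ t ht).1)
      (PlanarSystem.IsDominatedPair.coeff_ne_zero e₁ hb hm hi₁)
      (PlanarSystem.IsDominatedPair.coeff_ne_zero e₂ hb hm hi₂)
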